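/- Theorem. Let $X_1,\dots,X_N$ be IID random vectors in $\mathbb R^d$ with law $P$ having finite second moments, covariance matrix $\Sigma$, and mean $\theta(P)=\arg\min_{\theta\in\mathbb R^d}\mathbb E_P\|X-\theta\|_2^2$. Split $\{1,\dots,N\}$ into two disjoint parts $\mathcal I_1,\mathcal I_2$ with $|\mathcal I_2|=n\ge 1$, let $D_j=\{X_i:i\in\mathcal I_j\}$, and let $\widehat\theta_1=\widehat\theta_1(D_1)$ be any estimator computed from $D_1$. Put $m_\theta(x)=\|x-\theta\|_2^2$, let $\mathbb P_n$ be the empirical measure of $D_2$, let $$\widehat\sigma^2_{\theta,\theta'}=\frac1{n-1}\sum_{i\in\mathcal I_2}\bigl\{(m_\theta-m_{\theta'})(X_i)-\mathbb P_n(m_\theta-m_{\theta'})\bigr\}^2$$ (read as $0$ if $n=1$), let $z_\alpha$ be the $(1-\alpha)$-quantile of the standard normal law, and for $\alpha\in(0,1)$ define the CLT-based confidence set $$\widehat{\mathrm{CI}}^{\mathrm{mean}}_{n,\alpha}=\Bigl\{\theta\in\mathbb R^d:\ \mathbb P_n(m_\theta-m_{\widehat\theta_1})\le n^{-1/2}z_\alpha\,\widehat\sigma_{\theta,\widehat\theta_1}\Bigr\}.$$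 (i) For all $\alpha\in(0,1)$ and $\varepsilon>0$ there is a constant $\mathfrak C>0$, depending only on $\varepsilon$ and $\alpha$, such that, whenever $\mathrm{tr}(\Sigma)\le n$ and $s_n$ is a random variable with $$n^{-1/2}\sqrt{P(m_{\widehat\theta_1}-m_{\theta(P)})^2}+P(m_{\widehat\theta_1}-m_{\theta(P)})\le s_n\quad\text{a.s.}$$ (where $P f=\int f\,dP$ integrates over a fresh observation, with $\widehat\theta_1$ held fixed), $$\mathbb P_P\left(\mathrm{Diam}_{\|\cdot\|_2}\bigl(\widehat{\mathrm{CI}}^{\mathrm{mean}}_{n,\alpha}\bigr)\le\mathfrak C\left\{\Bigl(\frac{\mathrm{tr}(\Sigma)}n\Bigr)^{1/2}+s_n^{1/2}\right\}\right)\ge1-\varepsilon .$$ (ii) Let $(C_\delta)_{\delta>0}$ be constants. For every $\varepsilon>0$ there is $N_\varepsilon$ (depending only on $\varepsilon$ and $(C_\delta)$), and for every $\alpha\in(0,1)$ a constant $\mathfrak C>0$ (depending only on $\varepsilon$, $\alpha$ and $(C_\delta)$), such that, for all $n\ge N_\varepsilon$, all dimensions $d$ and all $P$: if $$\mathbb P_P\left(\|\widehat\theta_1-\theta(P)\|_2^2\le\frac{C_\delta\,\mathrm{tr}(\Sigma)}n\right)\ge1-\delta\qquad\text{for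 every }\delta>0,$$ then $$\mathbb P_P\left(\mathrm{Diam}_{\|\cdot\|_2}\bigl(\widehat{\mathrm{CI}}^{\mathrm{mean}}_{n,\alpha}\bigr)\le\mathfrak C\Bigl(\frac{\mathrm{tr}(\Sigma)}n\Bigr)^{1/2}\right)\ge1-\varepsilon .$$ No restriction is placed on $d$, and in (ii) none on $\mathrm{tr}(\Sigma)$. -/

import Mathlib

open MeasureTheory ProbabilityTheory

namespace MEst

noncomputable section

/-- The event `A` has probability at least `p`. For a (null-)measurable event this is `p ≤ μ A`;
in general it says that the inner probability of `A` is at least `p`, so no measurability of `A` is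
presupposed and the claim is never weakened by the outer measure of a non-measurable set. -/
def ProbAtLeast {Ω : Type*} [MeasurableSpace Ω] (μ : Measure Ω) (p : ℝ) (A : Set Ω) : Prop :=
  ∃ B : Set Ω, MeasurableSet B ∧ B ⊆ A ∧ ENNReal.ofReal p ≤ μ B

/-! ### M-estimation with a loss `m : Θ → Z → ℝ` -/

/-- The population criterion `M(θ, P) = ∫ m_θ dP`. -/
def risk {Θ Z : Type*} [MeasurableSpace Z] (m : Θ → Z → ℝ) (P : Measure Z) (θ : Θ) : ℝ :=
  ∫ z, m θ z ∂P

/-- The set of minimizers of the population criterion, `argmin_θ M(θ, P)`. -/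
def minimizers {Θ Z : Type*} [MeasurableSpace Z] (m : Θ → Z → ℝ) (P : Measure Z) : Set Θ :=
  {θ | ∀ θ' : Θ, risk m P θ ≤ risk m P θ'}

/-- The curvature `C_P(θ) = M(θ, P) - M(θ(P), P)`, where `θP` stands for `θ(P)`. -/
def curvature {Θ Z : Type*} [MeasurableSpace Z] (m : Θ → Z → ℝ) (P : Measure Z) (θP θ : Θ) : ℝ :=
  risk m P θ - risk m P θP

/-- The quantity `n^{-1/2} √(P (m_θ - m_{θ(P)})²) + C_P(θ)`, to be evaluated at the initial
estimator. -/
def initialError {Θ Z : Type*} [MeasurableSpace Z] (m : Θ → Z → ℝ) (P : Measure Z) (n : ℕ)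
    (θP θ : Θ) : ℝ :=
  (Real.sqrt n)⁻¹ * Real.sqrt (∫ z, (m θ z - m θP z) ^ 2 ∂P) + curvature m P θP θ

/-- The empirical mean `P_n f` over the sample `D`. -/
def empMean {ι Z : Type*} [Fintype ι] (D : ι → Z) (f : Z → ℝ) : ℝ :=
  (Fintype.card ι : ℝ)⁻¹ * ∑ i, f (D i)

/-- The sample variance of `f` over the sample `D`, with normalization `1 / (n - 1)`; it is `0` for
a sample of size `1`. -/
def sampleVar {ι Z : Type*} [Fintype ι] (D : ι → Z) (f : Z → ℝ) : ℝ :=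
  ((Fintype.card ι : ℝ) - 1)⁻¹ * ∑ i, (f (D i) - empMean D f) ^ 2

/-- The `(1 - α)`-quantile `z_α` of the standard normal distribution. -/
def zQuantile (α : ℝ) : ℝ :=
  sInf {t : ℝ | 1 - α ≤ cdf (gaussianReal 0 1) t}

/-- The CLT-based confidence set computed from the sample `D` and the initial value `θ₁`:
all `θ` with `P_n (m_θ - m_{θ₁}) ≤ n^{-1/2} z_α σ̂_{θ, θ₁}`. -/
def cltSet {Θ Z ι : Type*} [Fintype ι] (m : Θ → Z → ℝ) (α : ℝ) (θ₁ : Θ) (D : ι → Z) : Set Θ :=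
  {θ | empMean D (fun z => m θ z - m θ₁ z) ≤
    (Real.sqrt (Fintype.card ι))⁻¹ * zQuantile α *
      Real.sqrt (sampleVar D (fun z => m θ z - m θ₁ z))}

/-! ### The mean problem in `ℝᵈ` -/

/-- The squared Euclidean loss `m_θ(x) = ‖x - θ‖₂²`. -/
def sqLoss {d : ℕ} (θ x : EuclideanSpace ℝ (Fin d)) : ℝ := ‖x - θ‖ ^ 2

/-- The covariance matrix `Σ` of a distribution on `ℝᵈ`. -/
def covMat {d : ℕ} (P : Measure (EuclideanSpace ℝ (Fin d))) : Matrix (Fin d) (Fin d) ℝ :=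
  Matrix.of fun i j => covariance (fun x => x i) (fun x => x j) P

/-- The part of the data indexed by `I`. -/
def subsample {N : ℕ} {Ω E : Type*} (X : Fin N → Ω → E) (I : Finset (Fin N)) (ω : Ω) : I → E :=
  fun i => X i ω

/-- The confidence set for the mean: the initial estimator `θ₁` is evaluated on the part `I₁` of the
data and the CLT-based confidence set for the squared loss is computed on the part `I₂`. -/
def meanCI {d N : ℕ} {Ω : Type*} (α : ℝ) (X : Fin N → Ω → EuclideanSpace ℝ (Fin d))
    (I₁ I₂ : Finset (Fin N))
    (θ₁ : (I₁ → EuclideanSpace ℝ (Fin d)) → EuclideanSpace ℝ (Fin d)) (ω : Ω) :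
    Set (EuclideanSpace ℝ (Fin d)) :=
  cltSet sqLoss α (θ₁ (subsample X I₁ ω)) (subsample X I₂ ω)

/-- `X` is an IID sample of size `N` from a distribution `P` on `ℝᵈ` that has a covariance matrix,
the index set is split into the disjoint parts `I₁` and `I₂`, and `θ₁` is a (measurable) estimator
based on the part `I₁`. -/
structure IsSplitSample {d N : ℕ} {Ω : Type*} [MeasurableSpace Ω] (μ : Measure Ω)
    (P : Measure (EuclideanSpace ℝ (Fin d))) (X : Fin N → Ω → EuclideanSpace ℝ (Fin d))
    (I₁ I₂ : Finset (Fin N))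
    (θ₁ : (I₁ → EuclideanSpace ℝ (Fin d)) → EuclideanSpace ℝ (Fin d)) : Prop where
  memLp : MemLp id 2 P
  hasLaw : ∀ i, HasLaw (X i) P μ
  indep : iIndepFun X μ
  split : IsCompl I₁ I₂
  measurable : Measurable θ₁

end

end MEst

namespace MEst

/-! Put `u = θ - θ₁`, with `c` the mean of `P` and `b` the average of `D i - c` over the second
part. The loss difference is `‖u‖²` plus terms linear in `u`, while its sample standard deviation is
at most of order `‖u‖`. Membership in the set thus bounds `‖u‖²` by a multiple of `‖u‖`; cancelling
one factor gives, for every sample, `‖u‖ ≤ (2 + 3|z_α|) √dispersion + 2 ‖θ₁ - c‖`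
(`norm_sub_le_of_mem_cltSet`).

The dispersion does not involve `θ₁`, so no conditioning on the first part is needed: its
expectation is `2 tr Σ / n` (`integral_dispersion`), and Markov's inequality controls it in any
dimension. What remains is `‖θ₁ - c‖`, which is assumed small in (ii), while in (i) its square is
exactly the curvature term of the initial error. -/

/-! ### Inner probability and Markov's inequality -/

lemma ProbAtLeast.of_measure_compl_le {Ω : Type*} [MeasurableSpace Ω] {μ : Measure Ω}
    [IsProbabilityMeasure μ] {A : Set Ω} {ε : ℝ} (hε : 0 ≤ ε) (h : μ Aᶜ ≤ ENNReal.ofReal ε) :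
    ProbAtLeast μ (1 - ε) A := by
  -- Removing a measurable hull of `Aᶜ` leaves a measurable subset of `A`.
  refine ⟨(toMeasurable μ Aᶜ)ᶜ, (measurableSet_toMeasurable μ _).compl, ?_, ?_⟩
  · exact Set.compl_subset_comm.1 (subset_toMeasurable μ Aᶜ)
  · rw [prob_compl_eq_one_sub (measurableSet_toMeasurable μ _), measure_toMeasurable,
      ENNReal.ofReal_sub _ hε, ENNReal.ofReal_one]
    exact tsub_le_tsub_left h 1

lemma ProbAtLeast.measure_compl_le {Ω : Type*} [MeasurableSpace Ω] {μ : Measure Ω}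
    [IsProbabilityMeasure μ] {A : Set Ω} {ε : ℝ} (hε : 0 ≤ ε) (h : ProbAtLeast μ (1 - ε) A) :
    μ Aᶜ ≤ ENNReal.ofReal ε := by
  obtain ⟨B, hB, hBA, hp⟩ := h
  refine (measure_mono (Set.compl_subset_compl.2 hBA)).trans ?_
  rw [prob_compl_eq_one_sub hB]
  rw [ENNReal.ofReal_sub _ hε, ENNReal.ofReal_one] at hp
  exact tsub_le_iff_tsub_le.1 hp

/-- Markov's inequality. The strict inequality keeps it true for `a = 0`, where `f` vanishes almost
surely; this covers `tr Σ = 0`. -/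
lemma measure_lt_le_of_integral_le {Ω : Type*} [MeasurableSpace Ω] {μ : Measure Ω}
    [IsProbabilityMeasure μ] {f : Ω → ℝ} (hf : Integrable f μ) (h0 : 0 ≤ f) {a ε : ℝ}
    (ha : ∫ ω, f ω ∂μ ≤ a) (hε : 0 < ε) :
    μ {ω | a / ε < f ω} ≤ ENNReal.ofReal ε := by
  have hI : 0 ≤ ∫ ω, f ω ∂μ := integral_nonneg h0
  rcases (hI.trans ha).eq_or_lt with h | h
  · have hz : ∫ ω, f ω ∂μ = 0 := le_antisymm (h ▸ ha) hI
    have hae := (integral_eq_zero_iff_of_nonneg h0 hf).1 hz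
    have : μ {ω | a / ε < f ω} = 0 := by
      refine measure_mono_null (fun ω hω => ?_) (ae_iff.1 hae)
      simp only [Set.mem_ofPred_eq, ← h, zero_div] at hω
      exact hω.ne'
    simp [this]
  · have hM := mul_meas_ge_le_integral_of_nonneg (ae_of_all _ h0) hf (a / ε)
    have hr : μ.real {ω | a / ε ≤ f ω} ≤ ε := by
      have h1 : a / ε * μ.real {ω | a / ε ≤ f ω} ≤ a / ε * ε := by
        rw [div_mul_cancel₀ _ hε.ne']
        exact hM.trans ha
      exact le_of_mul_le_mul_left h1 (by positivity)
    calc μ {ω | a / ε < f ω} ≤ μ {ω | a / ε ≤ f ω} :=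
        measure_mono (Set.ofPred_subset_ofPred.2 fun ω hω => hω.le)
      _ ≤ ENNReal.ofReal ε := by
        rw [← ofReal_measureReal]
        exact ENNReal.ofReal_le_ofReal hr

/-! ### Deterministic bound on the confidence set -/

/-- The squared distance of the sample mean to `c` plus `1 / n` times the mean squared distance of
the observations to `c`. -/
noncomputable def dispersion {E ι : Type*} [NormedAddCommGroup E] [NormedSpace ℝ E] [Fintype ι]
    (D : ι → E) (c : E) : ℝ :=
  ‖(Fintype.card ι : ℝ)⁻¹ • ∑ i, (D i - c)‖ ^ 2 +
    (Fintype.card ι : ℝ)⁻¹ * ((Fintype.card ι : ℝ)⁻¹ * ∑ i, ‖D i - c‖ ^ 2)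

lemma dispersion_nonneg {E ι : Type*} [NormedAddCommGroup E] [NormedSpace ℝ E] [Fintype ι]
    (D : ι → E) (c : E) : 0 ≤ dispersion D c := by
  unfold dispersion
  positivity

/-- The empirical mean minimizes the sum of squared deviations, and `1 / (n - 1) ≤ 2 / n` for `n ≥
2`. -/
lemma sampleVar_le {ι Z : Type*} [Fintype ι] [Nonempty ι] (D : ι → Z) (f : Z → ℝ) (a : ℝ) :
    sampleVar D f ≤ 2 * ((Fintype.card ι : ℝ)⁻¹ * ∑ i, (f (D i) - a) ^ 2) := by
  have hn : (1 : ℝ) ≤ Fintype.card ι := by exact_mod_cast Fintype.card_pos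
  have hsum : ∑ i, f (D i) = Fintype.card ι * empMean D f := by
    unfold empMean
    rw [mul_inv_cancel_left₀ (by positivity)]
  have h1 : ∑ i, (f (D i) - empMean D f) ^ 2 ≤ ∑ i, (f (D i) - a) ^ 2 := by
    have key : ∑ i, (f (D i) - a) ^ 2 - ∑ i, (f (D i) - empMean D f) ^ 2 =
        Fintype.card ι * (empMean D f - a) ^ 2 := by
      rw [← Finset.sum_sub_distrib]
      have : ∀ i, (f (D i) - a) ^ 2 - (f (D i) - empMean D f) ^ 2 =
          f (D i) * (2 * (empMean D f - a)) + (a ^ 2 - empMean D f ^ 2) := fun i => by ring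
      simp only [this]
      rw [Finset.sum_add_distrib, ← Finset.sum_mul, hsum, Finset.sum_const, Finset.card_univ,
        nsmul_eq_mul]
      ring
    have : 0 ≤ Fintype.card ι * (empMean D f - a) ^ 2 := by positivity
    linarith
  have h2 : ((Fintype.card ι : ℝ) - 1)⁻¹ ≤ 2 * (Fintype.card ι : ℝ)⁻¹ := by
    rcases (Nat.one_le_iff_ne_zero.2 (Fintype.card_ne_zero (α := ι))).eq_or_lt with h | h
    -- For `n = 1` the left side is `0⁻¹ = 0`.
    · rw [← h]; norm_num
    · have h' : (2 : ℝ) ≤ Fintype.card ι := by exact_mod_cast h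
      rw [← div_eq_mul_inv, inv_eq_one_div, div_le_div_iff₀ (by linarith) (by linarith)]
      linarith
  unfold sampleVar
  calc _ ≤ 2 * (Fintype.card ι : ℝ)⁻¹ * ∑ i, (f (D i) - a) ^ 2 :=
        mul_le_mul h2 h1 (Finset.sum_nonneg fun i _ => sq_nonneg _) (by positivity)
    _ = _ := by ring

lemma sqLoss_sub_sqLoss {d : ℕ} (θ θ' x c : EuclideanSpace ℝ (Fin d)) :
    sqLoss θ x - sqLoss θ' x =
      ‖θ - θ'‖ ^ 2 - 2 * inner ℝ (c - θ') (θ - θ') - 2 * inner ℝ (x - c) (θ - θ') := by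
  unfold sqLoss
  have : x - θ = (x - θ') - (θ - θ') := by abel
  rw [this, norm_sub_sq_real]
  have h2 : x - θ' = (x - c) + (c - θ') := by abel
  rw [h2, inner_add_left]
  ring

lemma norm_sub_le_of_mem_cltSet {d : ℕ} {ι : Type*} [Fintype ι] [Nonempty ι] {α : ℝ}
    {θ θ₁ : EuclideanSpace ℝ (Fin d)} {D : ι → EuclideanSpace ℝ (Fin d)}
    (h : θ ∈ cltSet sqLoss α θ₁ D) (c : EuclideanSpace ℝ (Fin d)) :
    ‖θ - θ₁‖ ≤ (2 + 3 * |zQuantile α|) * √(dispersion D c) + 2 * ‖θ₁ - c‖ := by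
  set n : ℝ := (Fintype.card ι : ℝ) with hn_def
  have hn : 0 < n := Nat.cast_pos.2 Fintype.card_pos
  set u := θ - θ₁ with hu
  set b := n⁻¹ • ∑ i, (D i - c) with hb
  set T := n⁻¹ * ∑ i, ‖D i - c‖ ^ 2 with hT
  have hT0 : 0 ≤ T := by positivity
  set Q := √(dispersion D c) with hQ
  have hbQ : ‖b‖ ≤ Q := by
    refine Real.le_sqrt_of_sq_le ?_
    unfold dispersion
    rw [← hn_def, ← hb, ← hT]
    have : 0 ≤ n⁻¹ * T := by positivity
    linarith
  have hTQ : √(n⁻¹ * T) ≤ Q := by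
    refine Real.sqrt_le_sqrt ?_
    unfold dispersion
    rw [← hn_def, ← hb, ← hT]
    have : 0 ≤ ‖b‖ ^ 2 := by positivity
    linarith
  have hmean : empMean D (fun z => sqLoss θ z - sqLoss θ₁ z) =
      ‖u‖ ^ 2 - 2 * inner ℝ (c - θ₁) u - 2 * inner ℝ b u := by
    unfold empMean
    simp only [sqLoss_sub_sqLoss θ θ₁ _ c, ← hu]
    rw [Finset.sum_sub_distrib, Finset.sum_const, Finset.card_univ, nsmul_eq_mul,
      ← Finset.mul_sum, ← sum_inner, ← hn_def, hb, real_inner_smul_left]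
    field_simp
  have hvar : sampleVar D (fun z => sqLoss θ z - sqLoss θ₁ z) ≤ 8 * ‖u‖ ^ 2 * T := by
    -- Centring at the part that is constant in `x` leaves only `-2⟪x - c, u⟫`, to which
    -- Cauchy–Schwarz applies.
    refine (sampleVar_le D _ (‖u‖ ^ 2 - 2 * inner ℝ (c - θ₁) u)).trans ?_
    have : ∀ i, (sqLoss θ (D i) - sqLoss θ₁ (D i) -
        (‖u‖ ^ 2 - 2 * inner ℝ (c - θ₁) u)) ^ 2 ≤ 4 * ‖u‖ ^ 2 * ‖D i - c‖ ^ 2 := fun i => by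
      rw [sqLoss_sub_sqLoss θ θ₁ _ c, ← hu]
      have h1 := abs_real_inner_le_norm (D i - c) u
      have h2 : (inner ℝ (D i - c) u : ℝ) ^ 2 ≤ (‖D i - c‖ * ‖u‖) ^ 2 := by
        rw [← sq_abs]
        gcongr
      linear_combination 4 * h2
    calc _ ≤ 2 * (n⁻¹ * ∑ i, 4 * ‖u‖ ^ 2 * ‖D i - c‖ ^ 2) := by
          gcongr with i _
          exact this i
      _ = _ := by rw [← Finset.mul_sum, hT]; ring
  have hsd : (√n)⁻¹ * √(sampleVar D (fun z => sqLoss θ z - sqLoss θ₁ z)) ≤ 3 * ‖u‖ * Q := by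
    -- The constant 8 is rounded up to `3²` to come out of the root.
    calc _ ≤ (√n)⁻¹ * √((3 * ‖u‖) ^ 2 * T) := by
          gcongr
          refine hvar.trans ?_
          gcongr
          nlinarith [sq_nonneg ‖u‖]
      _ = 3 * ‖u‖ * √(n⁻¹ * T) := by
          rw [Real.sqrt_mul (by positivity), Real.sqrt_sq (by positivity),
            Real.sqrt_mul (by positivity) T, Real.sqrt_inv]
          ring
      _ ≤ _ := by gcongr
  have hineq : ‖u‖ ^ 2 - 2 * inner ℝ (c - θ₁) u - 2 * inner ℝ b u ≤
      |zQuantile α| * (3 * ‖u‖ * Q) := by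
    rw [← hmean]
    refine (h : empMean D _ ≤ _).trans ?_
    rw [← hn_def]
    -- The quantile is negative for `α > 1/2`, hence the absolute value.
    calc _ = zQuantile α *
          ((√n)⁻¹ * √(sampleVar D (fun z => sqLoss θ z - sqLoss θ₁ z))) := by ring
      _ ≤ |zQuantile α| *
          ((√n)⁻¹ * √(sampleVar D (fun z => sqLoss θ z - sqLoss θ₁ z))) := by
          gcongr
          exact le_abs_self _
      _ ≤ _ := by gcongr
  have h1 := real_inner_le_norm (c - θ₁) u
  have h2 := real_inner_le_norm b u
  have h3 : ‖b‖ * ‖u‖ ≤ Q * ‖u‖ := by gcongr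
  rw [norm_sub_rev c θ₁] at h1
  have hQ0 : 0 ≤ Q := Real.sqrt_nonneg _
  -- Every term of `hineq` is now controlled by a multiple of `‖u‖`, which is cancelled unless zero.
  rcases (norm_nonneg u).eq_or_lt with h0 | h0
  · rw [← h0]
    positivity
  · refine le_of_mul_le_mul_right ?_ h0
    linarith

lemma ediam_cltSet_le {d : ℕ} {ι : Type*} [Fintype ι] [Nonempty ι] (α : ℝ)
    (θ₁ : EuclideanSpace ℝ (Fin d)) (D : ι → EuclideanSpace ℝ (Fin d))
    (c : EuclideanSpace ℝ (Fin d)) :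
    Metric.ediam (cltSet sqLoss α θ₁ D) ≤ ENNReal.ofReal
      (2 * ((2 + 3 * |zQuantile α|) * √(dispersion D c) + 2 * ‖θ₁ - c‖)) := by
  refine Metric.ediam_le fun x hx y hy => ?_
  rw [edist_dist]
  refine ENNReal.ofReal_le_ofReal ?_
  have h1 := norm_sub_le_of_mem_cltSet hx c
  have h2 := norm_sub_le_of_mem_cltSet hy c
  have h3 := dist_triangle_right x y θ₁
  rw [dist_eq_norm x θ₁, dist_eq_norm y θ₁] at h3
  linarith

/-! ### Second moments and the population criterion -/

section Moments

variable {d : ℕ} {P : Measure (EuclideanSpace ℝ (Fin d))}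

/-- Bias–variance decomposition: the cross term integrates to zero around the mean. It identifies
the minimizer and the curvature. -/
lemma risk_sqLoss_eq [IsProbabilityMeasure P] (hP : MemLp id 2 P) (θ : EuclideanSpace ℝ (Fin d)) :
    risk sqLoss P θ = risk sqLoss P (∫ x, x ∂P) + ‖θ - ∫ x, x ∂P‖ ^ 2 := by
  set c := ∫ x, x ∂P with hc
  have hid : Integrable (fun x => x) P := hP.integrable (by norm_num)
  have hs : Integrable (fun x => sqLoss c x) P :=
    (hP.sub (memLp_const c)).integrable_norm_pow (by norm_num)
  have hi : Integrable (fun x => 2 * (inner ℝ (θ - c) (x - c) : ℝ)) P :=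
    ((hid.sub (integrable_const c)).const_inner (θ - c)).const_mul 2
  have hzero : ∫ x, (inner ℝ (θ - c) (x - c) : ℝ) ∂P = 0 := by
    have h := integral_inner (𝕜 := ℝ) (hid.sub (integrable_const c)) (θ - c)
    simp only [Pi.sub_apply] at h
    rw [h, integral_sub hid (integrable_const c)]
    simp [← hc]
  have heq : ∀ x, sqLoss θ x =
      sqLoss c x - 2 * (inner ℝ (θ - c) (x - c) : ℝ) + ‖θ - c‖ ^ 2 := fun x => by
    have h := sqLoss_sub_sqLoss θ c x c
    rw [sub_self, inner_zero_left, real_inner_comm] at h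
    linarith
  unfold risk
  simp only [heq]
  have h := integral_add (hs.sub hi) (integrable_const (‖θ - c‖ ^ 2))
  simp only [Pi.sub_apply] at h
  rw [h, integral_sub hs hi, integral_const_mul, hzero]
  simp

lemma eq_integral_of_mem_minimizers [IsProbabilityMeasure P] (hP : MemLp id 2 P)
    {θ : EuclideanSpace ℝ (Fin d)}
    (h : θ ∈ minimizers sqLoss P) : θ = ∫ x, x ∂P := by
  have h1 := h (∫ x, x ∂P)
  rw [risk_sqLoss_eq hP θ] at h1
  have h2 : ‖θ - ∫ x, x ∂P‖ ^ 2 = 0 := le_antisymm (by linarith) (by positivity)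
  exact sub_eq_zero.1 (norm_eq_zero.1 (pow_eq_zero_iff (two_ne_zero)|>.1 h2))

lemma memLp_apply (hP : MemLp id 2 P) (j : Fin d) : MemLp (fun x => x j) 2 P :=
  (EuclideanSpace.proj (𝕜 := ℝ) j).comp_memLp' hP

lemma integral_norm_sub_integral_sq {Ω : Type*} [MeasurableSpace Ω] {μ : Measure Ω}
    [IsProbabilityMeasure μ] {Y : Ω → EuclideanSpace ℝ (Fin d)} (hY : MemLp Y 2 μ) :
    ∫ ω, ‖Y ω - ∫ ω', Y ω' ∂μ‖ ^ 2 ∂μ = ∑ j, Var[fun ω => Y ω j; μ] := by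
  have hYj (j : Fin d) : MemLp (fun ω => Y ω j) 2 μ :=
    (EuclideanSpace.proj (𝕜 := ℝ) j).comp_memLp' hY
  have hj (j : Fin d) : (∫ ω, Y ω ∂μ) j = ∫ ω, Y ω j ∂μ :=
    ((EuclideanSpace.proj (𝕜 := ℝ) j).integral_comp_comm (hY.integrable (by norm_num))).symm
  simp only [EuclideanSpace.real_norm_sq_eq, PiLp.sub_apply, hj]
  rw [integral_finsetSum]
  · exact Finset.sum_congr rfl fun j _ => (variance_eq_integral (hYj j).aemeasurable).symm
  · exact fun j _ => ((hYj j).sub (memLp_const _)).integrable_sq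

lemma trace_covMat (hP : MemLp id 2 P) : (covMat P).trace = ∑ j, Var[fun x => x j; P] :=
  Finset.sum_congr rfl fun j _ => covariance_self (memLp_apply hP j).aemeasurable

lemma trace_covMat_nonneg (hP : MemLp id 2 P) : 0 ≤ (covMat P).trace := by
  rw [trace_covMat hP]
  exact Finset.sum_nonneg fun j _ => variance_nonneg _ _

lemma integral_norm_sub_sq_of_hasLaw [IsProbabilityMeasure P] (hP : MemLp id 2 P) {Ω : Type*}
    [MeasurableSpace Ω] {μ : Measure Ω} {X : Ω → EuclideanSpace ℝ (Fin d)} (hX : HasLaw X P μ) :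
    ∫ ω, ‖X ω - ∫ x, x ∂P‖ ^ 2 ∂μ = (covMat P).trace := by
  have h : ∫ ω, ‖X ω - ∫ x, x ∂P‖ ^ 2 ∂μ = ∫ y, ‖y - ∫ x, x ∂P‖ ^ 2 ∂P :=
    hX.integral_comp (f := fun y => ‖y - ∫ x, x ∂P‖ ^ 2)
      (Continuous.aestronglyMeasurable (by fun_prop))
  rw [h, trace_covMat hP, ← integral_norm_sub_integral_sq (μ := P) (Y := fun x => x) hP]

lemma memLp_sub_integral {ι Ω : Type*} [MeasurableSpace Ω] {μ : Measure Ω} [IsFiniteMeasure μ]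
    {X : ι → Ω → EuclideanSpace ℝ (Fin d)} (hP : MemLp id 2 P) (hX : ∀ i, HasLaw (X i) P μ) (i : ι) :
    MemLp (fun ω => X i ω - ∫ x, x ∂P) 2 μ := by
  have h : MemLp id 2 (μ.map (X i)) := (hX i).map_eq ▸ hP
  exact (h.comp_of_map (hX i).aemeasurable).sub (memLp_const _)

lemma memLp_mean_sub_integral {ι Ω : Type*} [Fintype ι] [MeasurableSpace Ω] {μ : Measure Ω}
    [IsFiniteMeasure μ] {X : ι → Ω → EuclideanSpace ℝ (Fin d)} (hP : MemLp id 2 P)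
    (hX : ∀ i, HasLaw (X i) P μ) :
    MemLp (fun ω => (Fintype.card ι : ℝ)⁻¹ • ∑ i, (X i ω - ∫ x, x ∂P)) 2 μ :=
  (memLp_finsetSum Finset.univ fun i _ => memLp_sub_integral hP hX i).const_smul
    (Fintype.card ι : ℝ)⁻¹

lemma integrable_dispersion {ι Ω : Type*} [Fintype ι] [MeasurableSpace Ω] {μ : Measure Ω}
    [IsFiniteMeasure μ] {X : ι → Ω → EuclideanSpace ℝ (Fin d)} (hP : MemLp id 2 P)
    (hX : ∀ i, HasLaw (X i) P μ) :
    Integrable (fun ω => dispersion (fun i => X i ω) (∫ x, x ∂P)) μ :=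
  ((memLp_mean_sub_integral hP hX).integrable_norm_pow (by norm_num)).add
    (((integrable_finsetSum _ fun i _ =>
      (memLp_sub_integral hP hX i).integrable_norm_pow (by norm_num)).const_mul _).const_mul _)

section Sample

variable {ι Ω : Type*} [Fintype ι] [Nonempty ι] [MeasurableSpace Ω] {μ : Measure Ω}
  [IsProbabilityMeasure μ] [IsProbabilityMeasure P] {X : ι → Ω → EuclideanSpace ℝ (Fin d)}

/-- Coordinatewise, variances of pairwise independent summands add. -/
lemma integral_norm_mean_sub_sq (hP : MemLp id 2 P) (hX : ∀ i, HasLaw (X i) P μ)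
    (hind : Pairwise fun i k => IndepFun (X i) (X k) μ) :
    ∫ ω, ‖(Fintype.card ι : ℝ)⁻¹ • ∑ i, (X i ω - ∫ x, x ∂P)‖ ^ 2 ∂μ =
      (covMat P).trace / Fintype.card ι := by
  have hn : (Fintype.card ι : ℝ) ≠ 0 := by simp
  have hid : Integrable (fun x => x) P := hP.integrable (by norm_num)
  have hmem := memLp_sub_integral hP hX
  have hY := memLp_mean_sub_integral hP hX
  set c := ∫ x, x ∂P with hc
  have hmean : ∫ ω, (Fintype.card ι : ℝ)⁻¹ • ∑ i, (X i ω - c) ∂μ = 0 := by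
    rw [integral_smul, integral_finsetSum _ fun i _ => (hmem i).integrable (by norm_num)]
    have : ∀ i, ∫ ω, (X i ω - c) ∂μ = 0 := fun i => by
      have h : ∫ ω, (X i ω - c) ∂μ = ∫ y, (y - c) ∂P :=
        (hX i).integral_comp (f := fun y => y - c)
          (Continuous.aestronglyMeasurable (by fun_prop))
      rw [h, integral_sub hid (integrable_const c)]
      simp [← hc]
    simp [this]
  have h := integral_norm_sub_integral_sq hY
  simp only [hmean, sub_zero] at h
  rw [h, trace_covMat hP, Finset.sum_div]
  refine Finset.sum_congr rfl fun j _ => ?_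
  have hsum : (fun ω => ((Fintype.card ι : ℝ)⁻¹ • ∑ i, (X i ω - c)) j) =
      fun ω => (Fintype.card ι : ℝ)⁻¹ * (∑ i, fun ω => (X i ω - c) j) ω := by
    ext ω
    simp
  have hmeas : Measurable fun x : EuclideanSpace ℝ (Fin d) => (x - c) j := by fun_prop
  have hmemj : ∀ i, MemLp (fun ω => (X i ω - c) j) 2 μ := fun i =>
    (EuclideanSpace.proj (𝕜 := ℝ) j).comp_memLp' (hmem i)
  rw [hsum, variance_const_mul, IndepFun.variance_sum (fun i _ => hmemj i)
    (fun i _ k _ hik => (hind hik).comp hmeas hmeas)]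
  have hvar : ∀ i, Var[fun ω => (X i ω - c) j; μ] = Var[fun x => x j; P] := fun i => by
    have h1 : Var[fun x => (x - c) j; P] = Var[fun x => x j; P] :=
      variance_sub_const (memLp_apply hP j).aestronglyMeasurable (c j)
    rw [← h1, ← (hX i).map_eq, variance_map hmeas.aemeasurable (hX i).aemeasurable]
    rfl
  simp only [hvar, Finset.sum_const, Finset.card_univ, nsmul_eq_mul]
  field_simp

lemma integral_dispersion (hP : MemLp id 2 P) (hX : ∀ i, HasLaw (X i) P μ)
    (hind : Pairwise fun i k => IndepFun (X i) (X k) μ) :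
    ∫ ω, dispersion (fun i => X i ω) (∫ x, x ∂P) ∂μ =
      2 * ((covMat P).trace / Fintype.card ι) := by
  have hn : (Fintype.card ι : ℝ) ≠ 0 := by simp
  have hint (i : ι) : Integrable (fun ω => ‖X i ω - ∫ x, x ∂P‖ ^ 2) μ :=
    (memLp_sub_integral hP hX i).integrable_norm_pow (by norm_num)
  unfold dispersion
  rw [integral_add ((memLp_mean_sub_integral hP hX).integrable_norm_pow (by norm_num))
      (((integrable_finsetSum _ fun i _ => hint i).const_mul _).const_mul _),
    integral_norm_mean_sub_sq hP hX hind, integral_const_mul, integral_const_mul,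
    integral_finsetSum _ fun i _ => hint i]
  simp only [fun i => integral_norm_sub_sq_of_hasLaw hP (hX i), Finset.sum_const,
    Finset.card_univ, nsmul_eq_mul]
  field_simp
  ring

end Sample

end Moments

/-! ### Probability bounds for the split sample -/

section SplitSample

variable {d N : ℕ} {Ω : Type*} [MeasurableSpace Ω] {μ : Measure Ω} [IsProbabilityMeasure μ]
  {P : Measure (EuclideanSpace ℝ (Fin d))} [IsProbabilityMeasure P]
  {X : Fin N → Ω → EuclideanSpace ℝ (Fin d)} {I₁ I₂ : Finset (Fin N)}
  {θ₁ : (I₁ → EuclideanSpace ℝ (Fin d)) → EuclideanSpace ℝ (Fin d)}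
  {θP : EuclideanSpace ℝ (Fin d)}

lemma norm_sub_le_sqrt_initialError (hP : MemLp id 2 P) (hθ : θP ∈ minimizers sqLoss P)
    (n : ℕ) (θ : EuclideanSpace ℝ (Fin d)) :
    ‖θ - θP‖ ≤ √(initialError sqLoss P n θP θ) := by
  refine Real.le_sqrt_of_sq_le ?_
  rw [initialError, curvature, risk_sqLoss_eq hP θ, ← eq_integral_of_mem_minimizers hP hθ,
    add_sub_cancel_left]
  exact le_add_of_nonneg_left (by positivity)

lemma IsSplitSample.measure_lt_dispersion_le (h : IsSplitSample μ P X I₁ I₂ θ₁)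
    (hθ : θP ∈ minimizers sqLoss P) (hn : 1 ≤ I₂.card) {ε : ℝ} (hε : 0 < ε) :
    μ {ω | 2 * ((covMat P).trace / I₂.card) / ε < dispersion (subsample X I₂ ω) θP} ≤
      ENNReal.ofReal ε := by
  have : Nonempty I₂ := (Finset.card_pos.1 hn).to_subtype
  have hX : ∀ i : I₂, HasLaw (X i) P μ := fun i => h.hasLaw i
  rw [eq_integral_of_mem_minimizers h.memLp hθ]
  refine measure_lt_le_of_integral_le (integrable_dispersion h.memLp hX)
    (fun ω => dispersion_nonneg _ _) ?_ hε
  rw [integral_dispersion h.memLp hX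
    fun i k hik => h.indep.indepFun (Subtype.coe_injective.ne hik), Fintype.card_coe]

/-- If the initial estimator is within `r ω` of the mean outside an event of probability `ε`, then
the diameter of the confidence set is of order `√(tr Σ / n) + r ω` with probability `1 - 2 ε`. -/
lemma IsSplitSample.probAtLeast_ediam_meanCI_le (h : IsSplitSample μ P X I₁ I₂ θ₁)
    (hθ : θP ∈ minimizers sqLoss P) (hn : 1 ≤ I₂.card) {ε : ℝ} (hε : 0 < ε) (α : ℝ) {r : Ω → ℝ}
    (hr : μ {ω | ‖θ₁ (subsample X I₁ ω) - θP‖ ≤ r ω}ᶜ ≤ ENNReal.ofReal ε) :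
    ProbAtLeast μ (1 - 2 * ε) {ω | Metric.ediam (meanCI α X I₁ I₂ θ₁ ω) ≤ ENNReal.ofReal
      (2 * ((2 + 3 * |zQuantile α|) * √(2 / ε) * √((covMat P).trace / I₂.card) + 2 * r ω))} := by
  have : Nonempty I₂ := (Finset.card_pos.1 hn).to_subtype
  refine .of_measure_compl_le (by positivity) ?_
  refine (measure_mono (t := {ω | ‖θ₁ (subsample X I₁ ω) - θP‖ ≤ r ω}ᶜ ∪
    {ω | 2 * ((covMat P).trace / I₂.card) / ε < dispersion (subsample X I₂ ω) θP})
    fun ω hω => ?_).trans ((measure_union_le _ _).trans ?_)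
  · by_contra hcon
    rw [Set.mem_union, not_or, Set.mem_compl_iff, not_not] at hcon
    obtain ⟨h1, h2⟩ := hcon
    replace h1 : ‖θ₁ (subsample X I₁ ω) - θP‖ ≤ r ω := h1
    replace h2 : dispersion (subsample X I₂ ω) θP ≤ 2 * ((covMat P).trace / I₂.card) / ε :=
      not_lt.1 h2
    refine hω ((ediam_cltSet_le α _ _ θP).trans (ENNReal.ofReal_le_ofReal ?_))
    have h3 : √(dispersion (subsample X I₂ ω) θP) ≤
        √(2 / ε) * √((covMat P).trace / I₂.card) := by
      rw [← Real.sqrt_mul (by positivity)]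
      exact Real.sqrt_le_sqrt (h2.trans_eq (by ring))
    rw [mul_assoc (2 + 3 * |zQuantile α|)]
    gcongr
  · rw [two_mul ε, ENNReal.ofReal_add hε.le hε.le]
    exact add_le_add hr (h.measure_lt_dispersion_le hθ hn hε)

end SplitSample

end MEst

theorem mainTheorem9 :
    (∀ α ∈ Set.Ioo (0 : ℝ) 1, ∀ ε > (0 : ℝ), ∃ K > (0 : ℝ),
      ∀ (d N : ℕ) (Ω : Type*) [MeasurableSpace Ω] (μ : Measure Ω) [IsProbabilityMeasure μ]
        (P : Measure (EuclideanSpace ℝ (Fin d))) [IsProbabilityMeasure P]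
        (X : Fin N → Ω → EuclideanSpace ℝ (Fin d)) (I₁ I₂ : Finset (Fin N))
        (θ₁ : (I₁ → EuclideanSpace ℝ (Fin d)) → EuclideanSpace ℝ (Fin d))
        (θP : EuclideanSpace ℝ (Fin d)) (s : Ω → ℝ),
        MEst.IsSplitSample μ P X I₁ I₂ θ₁ →
        θP ∈ MEst.minimizers MEst.sqLoss P →
        1 ≤ I₂.card →
        (MEst.covMat P).trace ≤ I₂.card →
        AEMeasurable s μ →
        (∀ᵐ ω ∂μ, MEst.initialError MEst.sqLoss P I₂.card θP
          (θ₁ (MEst.subsample X I₁ ω)) ≤ s ω) →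
        MEst.ProbAtLeast μ (1 - ε)
          {ω | Metric.ediam (MEst.meanCI α X I₁ I₂ θ₁ ω) ≤
            ENNReal.ofReal (K * (Real.sqrt ((MEst.covMat P).trace / I₂.card) +
              Real.sqrt (s ω)))}) ∧
    (∀ C : ℝ → ℝ, ∀ ε > (0 : ℝ), ∃ n₀ : ℕ, ∀ α ∈ Set.Ioo (0 : ℝ) 1, ∃ K > (0 : ℝ),
      ∀ (d N : ℕ) (Ω : Type*) [MeasurableSpace Ω] (μ : Measure Ω) [IsProbabilityMeasure μ]
        (P : Measure (EuclideanSpace ℝ (Fin d))) [IsProbabilityMeasure P]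
        (X : Fin N → Ω → EuclideanSpace ℝ (Fin d)) (I₁ I₂ : Finset (Fin N))
        (θ₁ : (I₁ → EuclideanSpace ℝ (Fin d)) → EuclideanSpace ℝ (Fin d))
        (θP : EuclideanSpace ℝ (Fin d)),
        MEst.IsSplitSample μ P X I₁ I₂ θ₁ →
        θP ∈ MEst.minimizers MEst.sqLoss P →
        n₀ ≤ I₂.card →
        (∀ δ > (0 : ℝ), MEst.ProbAtLeast μ (1 - δ)
          {ω | ‖θ₁ (MEst.subsample X I₁ ω) - θP‖ ^ 2 ≤
            C δ * (MEst.covMat P).trace / I₂.card}) →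
        MEst.ProbAtLeast μ (1 - ε)
          {ω | Metric.ediam (MEst.meanCI α X I₁ I₂ θ₁ ω) ≤
            ENNReal.ofReal (K * Real.sqrt ((MEst.covMat P).trace / I₂.card))}) := by
  constructor
  · intro α _ ε hε
    -- Half of `ε` goes to the dispersion event; adding the coefficients of the two terms gives one
    -- constant for both.
    refine ⟨2 * ((2 + 3 * |MEst.zQuantile α|) * √(2 / (ε / 2)) + 2), by positivity, ?_⟩
    intro d N Ω _ μ _ P _ X I₁ I₂ θ₁ θP s h hθ hn _ _ hs
    have key := h.probAtLeast_ediam_meanCI_le hθ hn (half_pos hε) α (r := fun ω => √(s ω)) (by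
      refine le_of_eq_of_le (ae_iff.1 ?_) zero_le
      filter_upwards [hs] with ω hω
      exact (MEst.norm_sub_le_sqrt_initialError h.memLp hθ _ _).trans (Real.sqrt_le_sqrt hω))
    rw [mul_div_cancel₀ _ two_ne_zero] at key
    obtain ⟨B, hB, hBA, hp⟩ := key
    refine ⟨B, hB, fun ω hω => (hBA hω).trans (ENNReal.ofReal_le_ofReal ?_), hp⟩
    have h1 : 0 ≤ (2 + 3 * |MEst.zQuantile α|) * √(2 / (ε / 2)) * √(s ω) := by positivity
    have h2 := Real.sqrt_nonneg ((MEst.covMat P).trace / I₂.card)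
    linarith
  · intro C ε hε
    -- The bound is non-asymptotic, so a nonempty second part suffices.
    refine ⟨1, fun α _ => ?_⟩
    refine ⟨2 * ((2 + 3 * |MEst.zQuantile α|) * √(2 / (ε / 2)) + 2 * √(C (ε / 2))),
      by positivity, ?_⟩
    intro d N Ω _ μ _ P _ X I₁ I₂ θ₁ θP h hθ hn hC
    have key := h.probAtLeast_ediam_meanCI_le hθ hn (half_pos hε) α
      (r := fun _ => √(C (ε / 2)) * √((MEst.covMat P).trace / I₂.card)) (by
        refine (measure_mono (Set.compl_subset_compl.2 ?_)).trans
          ((hC (ε / 2) (half_pos hε)).measure_compl_le (half_pos hε).le)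
        refine Set.ofPred_subset_ofPred.2 fun ω hω => ?_
        -- Only `tr Σ / n` has to be nonnegative here; no sign is assumed for `C (ε / 2)`.
        rw [← Real.sqrt_mul' _ (div_nonneg (MEst.trace_covMat_nonneg h.memLp) (by positivity)),
          ← mul_div_assoc]
        exact Real.le_sqrt_of_sq_le hω)
    rw [mul_div_cancel₀ _ two_ne_zero] at key
    obtain ⟨B, hB, hBA, hp⟩ := key
    exact ⟨B, hB, fun ω hω => (hBA hω).trans (ENNReal.ofReal_le_ofReal (by linarith)), hp⟩
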